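/- Conventions. Structures are relational, with an arbitrary signature; a finite structure is one whose domain is finite and nonempty. A clone on a set $C$ is a set of operations $C^n\to C$ $(n\ge 1)$ containing all projections and closed under composition; $\operatorname{Pol}(\mathbb A)$ is the clone of all polymorphisms of $\mathbb A$ (homomorphisms $\mathbb A^n\to\mathbb A$, $n\ge 1$). A minor condition is a finite set of identities of the form $\forall x_1,\dots,x_n\colon f(x_{\sigma(1)},\dots,x_{\sigma(m)})=g(x_{\tau(1)},\dots,x_{\tau(k)})$ in finitely many function symbols of positive arities; a clone satisfies it if the symbols can be interpreted by operations of the clone such that all the identities hold. A structure $\mathbb A$ pp-constructs a structure $\mathbb B$ if for some $d\ge 1$ the structure $\mathbb B$ is homomorphically equivalent to a structure with domain $A^d$ all of whose relations ($k$-ary relations on $A^d$ being regarded as $kd$-ary relations on $A$) are definable in $\mathbb A$ by primitive positive formulas (built from atomic formulas, equalities and $\bot$ by conjunction and existential quantification). $\mathbb P_1$ is the digraph with two vertices and a single edge from one to the other. The quasi Maltsev condition is $f(x,x,x)=f(x,y,y)=f(y,y,x)$. For an action of a finite group $H$ on a finite nonempty set $Y$, the condition $\Sigma(H\curvearrowright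 Y)$ asks for an operation $f$ whose arguments are indexed by $Y$ with $f(t)=f(t_h)$ for all tuples $t$ and all $h\in H$, where $t_h(y)=t(hy)$. For a group $G$, $\operatorname{prim}(G)$ is the disjoint union of all primitive $G$-sets up to isomorphism, one from each isomorphism class; a $G$-set is primitive if it is transitive, has more than one element, and the only partitions respected by $G$ are the two trivial ones. Theorem. Let $E$ be a set of minor conditions such that for every finite structure $\mathbb A$: if $\operatorname{Pol}(\mathbb A)$ satisfies every $\Sigma\in E$, then $\mathbb P_1$ pp-constructs $\mathbb A$. Then for every condition $\Sigma'$ in $$\{\text{quasi Maltsev}\}\cup\{\Sigma(G\curvearrowright\operatorname{prim}(G)) : G \text{ a finite simple group}\}$$ there is a single condition $\Sigma\in E$ such that every clone over a finite domain that satisfies $\Sigma$ also satisfies $\Sigma'$. -/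

import Mathlib

open scoped FirstOrder

universe u v

/-! ### Clones -/

/-- A clone on `C`: for every arity `n ≥ 1` a set `ops n` of operations `Cⁿ → C`, containing all
projections and closed under composition. There are no operations of arity `0`. -/
structure Clone (C : Type u) where
  ops : (n : ℕ) → Set ((Fin n → C) → C)
  arity_pos : ∀ {n : ℕ} {f : (Fin n → C) → C}, f ∈ ops n → 0 < n
  proj_mem : ∀ {n : ℕ} (i : Fin n), (fun c : Fin n → C => c i) ∈ ops n
  comp_mem : ∀ {n m : ℕ} {f : (Fin n → C) → C} {g : Fin n → (Fin m → C) → C},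
    f ∈ ops n → (∀ i, g i ∈ ops m) → (fun c : Fin m → C => f (fun i => g i c)) ∈ ops m

/-- `f : Aⁿ → A` is a homomorphism from the `n`-th power of the relational structure `A` to `A`:
applied coordinatewise to `n` tuples of a relation, it gives a tuple of that relation. -/
def IsPolymorphism (L : FirstOrder.Language) [L.IsRelational] (A : Type u) [L.Structure A] {n : ℕ}
    (f : (Fin n → A) → A) : Prop :=
  ∀ (k : ℕ) (R : L.Relations k) (t : Fin n → Fin k → A),
    (∀ i, FirstOrder.Language.Structure.RelMap R (t i)) →
      FirstOrder.Language.Structure.RelMap R (fun j => f (fun i => t i j))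

/-- The polymorphism clone of a relational structure. -/
def Pol (L : FirstOrder.Language) [L.IsRelational] (A : Type u) [L.Structure A] : Clone A where
  ops n := {f | 0 < n ∧ IsPolymorphism L A f}
  arity_pos h := h.1
  proj_mem i := ⟨i.pos, fun _ _ _ ht => ht i⟩
  comp_mem hf hg :=
    ⟨(hg ⟨0, hf.1⟩).1, fun k R t ht => hf.2 k R _ (fun i => (hg i).2 k R t ht)⟩

/-! ### Minor conditions -/

/-- A minor identity
`∀ x₁ … x_nvars, f_lhs (x_σ(1), …) = f_rhs (x_τ(1), …)`
between function symbols `f_i` of arities `arity i`. -/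
structure MinorIdentity {k : ℕ} (arity : Fin k → ℕ) where
  lhs : Fin k
  rhs : Fin k
  nvars : ℕ
  σ : Fin (arity lhs) → Fin nvars
  τ : Fin (arity rhs) → Fin nvars

/-- A minor condition: finitely many function symbols of positive arities and a finite set of
minor identities in them. -/
structure MinorCondition where
  numSymbols : ℕ
  arity : Fin numSymbols → ℕ
  arity_pos : ∀ i, 0 < arity i
  identities : Set (MinorIdentity arity)
  finite_identities : identities.Finite

/-- The clone `𝒞` satisfies the minor condition `S`: the function symbols can be interpreted by
operations of `𝒞` so that all identities hold. -/
def Clone.Satisfies {C : Type u} (𝒞 : Clone C) (S : MinorCondition) : Prop :=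
  ∃ f : (i : Fin S.numSymbols) → (Fin (S.arity i) → C) → C,
    (∀ i, f i ∈ 𝒞.ops (S.arity i)) ∧
    ∀ e ∈ S.identities, ∀ x : Fin e.nvars → C,
      f e.lhs (fun i => x (e.σ i)) = f e.rhs (fun i => x (e.τ i))

/-- `S` implies `S'` for clones over a finite domain. -/
def MinorCondition.ImpliesOnFinite (S S' : MinorCondition) : Prop :=
  ∀ (C : Type u) [Finite C] (𝒞 : Clone C), 𝒞.Satisfies S → 𝒞.Satisfies S'

/-- The quasi Maltsev condition `f(x,x,x) = f(x,y,y) = f(y,y,x)`. -/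
def quasiMaltsev : MinorCondition where
  numSymbols := 1
  arity _ := 3
  arity_pos _ := by decide
  identities :=
    {⟨0, 0, 2, ![0, 0, 0], ![0, 1, 1]⟩, ⟨0, 0, 2, ![0, 1, 1], ![1, 1, 0]⟩}
  finite_identities := Set.toFinite _

/-- The condition `Σ(H ↷ Y)` of an action of a finite group `H` on a finite nonempty set `Y`: one
function symbol `f` of arity `|Y|`, and the identities `f(t) = f(t_h)` for all `h ∈ H`, where
`t_h(y) = t(h • y)`. The arguments of `f` are numbered along a bijection of `Y` with
`Fin (Nat.card Y)`. -/
noncomputable def actionCondition (H : Type v) (Y : Type v) [Group H] [MulAction H Y]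
    [Finite H] [Finite Y] [Nonempty Y] : MinorCondition where
  numSymbols := 1
  arity _ := Nat.card Y
  arity_pos _ := Nat.card_pos
  identities := Set.range fun h : H =>
    ⟨0, 0, Nat.card Y, id, fun i => Finite.equivFin Y (h • (Finite.equivFin Y).symm i)⟩
  finite_identities := Set.finite_range _

/-! ### The union of all primitive actions of a group -/

/-- Isomorphism of `G`-sets. -/
def GSetIso (G : Type v) [Group G] (X Y : Type*) [MulAction G X] [MulAction G Y] : Prop :=
  ∃ e : X ≃ Y, ∀ (g : G) (x : X), e (g • x) = g • e x

/-- Two maximal subgroups are identified when their coset spaces are isomorphic `G`-sets. -/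
def primSetoid (G : Type v) [Group G] : Setoid {M : Subgroup G // IsCoatom M} where
  r M N := GSetIso G (G ⧸ M.1) (G ⧸ N.1)
  iseqv :=
    { refl := fun _ => ⟨Equiv.refl _, fun _ _ => rfl⟩
      symm := fun ⟨e, he⟩ => ⟨e.symm, fun g x => by
        rw [Equiv.symm_apply_eq, he, Equiv.apply_symm_apply]⟩
      trans := fun ⟨e, he⟩ ⟨f, hf⟩ => ⟨e.trans f, fun g x => by
        simp only [Equiv.trans_apply, he, hf]⟩ }

/-- The isomorphism classes of primitive `G`-sets; see `primComponent_isPrimitive` and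
`existsUnique_primComponent`. -/
abbrev PrimIndex (G : Type v) [Group G] : Type v := Quotient (primSetoid G)

/-- A representative of an isomorphism class of primitive `G`-sets. -/
abbrev PrimComponent (G : Type v) [Group G] (q : PrimIndex G) : Type v :=
  G ⧸ (Quotient.out q).1

/-- `prim(G)`: the disjoint union of all primitive `G`-sets up to isomorphism, each taken once.
`G` acts on every component simultaneously. -/
abbrev Prim (G : Type v) [Group G] : Type v := Σ q : PrimIndex G, PrimComponent G q

/-- Every component of `prim(G)` is a primitive `G`-set. -/
theorem primComponent_isPrimitive (G : Type v) [Group G] (q : PrimIndex G) :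
    Nontrivial (PrimComponent G q) ∧ MulAction.IsPreprimitive G (PrimComponent G q) := by
  have hM : IsCoatom (Quotient.out q).1 := (Quotient.out q).2
  have hn : Nontrivial (PrimComponent G q) := by
    by_contra h
    rw [not_nontrivial_iff_subsingleton] at h
    exact hM.1 (QuotientGroup.subgroup_eq_top_of_subsingleton _ h)
  refine ⟨hn, (MulAction.isCoatom_stabilizer_iff_preprimitive G
    ((1 : G) : PrimComponent G q)).1 ?_⟩
  rwa [MulAction.stabilizer_quotient]

/-- Every primitive `G`-set is isomorphic to exactly one component of `prim(G)`. -/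
theorem existsUnique_primComponent (G : Type v) [Group G] (X : Type*) [MulAction G X]
    [Nontrivial X] [MulAction.IsPreprimitive G X] :
    ∃! q : PrimIndex G, GSetIso G X (PrimComponent G q) := by
  obtain ⟨x⟩ : Nonempty X := inferInstance
  have key : GSetIso G (G ⧸ MulAction.stabilizer G x) X := by
    refine ⟨Equiv.ofBijective (MulAction.ofQuotientStabilizer G x)
      ⟨MulAction.injective_ofQuotientStabilizer G x, fun y => ?_⟩, fun g y => ?_⟩
    · obtain ⟨g, hg⟩ := MulAction.exists_smul_eq G x y
      exact ⟨(g : G ⧸ MulAction.stabilizer G x), hg⟩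
    · exact MulAction.ofQuotientStabilizer_smul G x g y
  obtain ⟨e, he⟩ := key
  let M : {M : Subgroup G // IsCoatom M} :=
    ⟨MulAction.stabilizer G x,
      MulAction.IsPreprimitive.isCoatom_stabilizer_of_isPreprimitive G x⟩
  refine ⟨Quotient.mk _ M, ?_, ?_⟩
  · obtain ⟨f, hf⟩ := (primSetoid G).symm (Quotient.mk_out (s := primSetoid G) M)
    exact ⟨e.symm.trans f, fun g y => by
      have : e.symm (g • y) = g • e.symm y := by
        rw [Equiv.symm_apply_eq, he, Equiv.apply_symm_apply]
      rw [Equiv.trans_apply, this, hf, Equiv.trans_apply]⟩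
  · rintro q ⟨f, hf⟩
    rw [← Quotient.out_eq q]
    refine Quotient.sound ((primSetoid G).symm ⟨e.trans f, fun g y => ?_⟩)
    rw [Equiv.trans_apply, he, hf, Equiv.trans_apply]

instance Prim.instNonempty (G : Type v) [Group G] [Finite G] [Nontrivial G] :
    Nonempty (Prim G) := by
  obtain ⟨M, hM, -⟩ := (eq_top_or_exists_le_coatom (⊥ : Subgroup G)).resolve_left bot_ne_top
  exact ⟨⟨Quotient.mk _ ⟨M, hM⟩, (1 : G)⟩⟩

/-! ### Primitive positive constructions -/

/-- Primitive positive formulas: built from atomic formulas and `⊥` by conjunction and existential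
quantification. -/
inductive IsPP {L : FirstOrder.Language} {α : Type*} : {n : ℕ} → L.BoundedFormula α n → Prop
  | atomic {n : ℕ} {φ : L.BoundedFormula α n} : φ.IsAtomic → IsPP φ
  | falsum {n : ℕ} : IsPP (⊥ : L.BoundedFormula α n)
  | inf {n : ℕ} {φ ψ : L.BoundedFormula α n} : IsPP φ → IsPP ψ → IsPP (φ ⊓ ψ)
  | ex {n : ℕ} {φ : L.BoundedFormula α (n + 1)} : IsPP φ → IsPP φ.ex

/-- A `k`-ary relation on `A^d`, regarded as a `kd`-ary relation on `A`, is pp-definable in `A`. -/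
def IsPPDefinable (L : FirstOrder.Language) (A : Type*) [L.Structure A] {k d : ℕ}
    (R : (Fin k → Fin d → A) → Prop) : Prop :=
  ∃ φ : L.Formula (Fin k × Fin d), IsPP φ ∧
    ∀ t : Fin k → Fin d → A, R t ↔ φ.Realize (fun p => t p.1 p.2)

/-- Homomorphic equivalence of two `L`-structures. -/
def HomEquivalent (L : FirstOrder.Language) (A B : Type*) [L.Structure A] [L.Structure B] : Prop :=
  Nonempty (A →[L] B) ∧ Nonempty (B →[L] A)

/-- The relational structure `A` pp-constructs the relational structure `B`: for some `d ≥ 1` there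
is a structure with domain `A^d` in the language of `B`, all of whose relations are pp-definable in
`A`, that is homomorphically equivalent to `B`. -/
def PPConstructs (L : FirstOrder.Language) [L.IsRelational] (A : Type*) [L.Structure A]
    (L' : FirstOrder.Language) [L'.IsRelational] (B : Type*) [L'.Structure B] : Prop :=
  ∃ (d : ℕ) (_ : 0 < d) (_ : L'.Structure (Fin d → A)),
    (∀ (k : ℕ) (R : L'.Relations k),
      IsPPDefinable L A (fun t : Fin k → Fin d → A => FirstOrder.Language.Structure.RelMap R t)) ∧
    HomEquivalent L' (Fin d → A) B

/-- The vertices of the digraph `P₁`. -/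
inductive P1 : Type
  | source
  | target

instance P1.instIsRelational : FirstOrder.Language.graph.IsRelational :=
  fun _ => inferInstanceAs (IsEmpty Empty)

/-- The digraph `P₁`: two vertices and a single edge, from `source` to `target`. -/
instance P1.instStructure : FirstOrder.Language.graph.Structure P1 where
  RelMap {n} (R : FirstOrder.Language.graphRel n) := match n, R with
    | _, .adj => fun t => t 0 = .source ∧ t 1 = .target

/-! ### Minor homomorphisms -/

/-! Each target condition `S'` has a finite structure `B` whose polymorphism clone is universal
among the clones failing `S'`: it fails `S'`, and every clone failing `S'` has a minor homomorphism
to it. Suppose no member of `E` implies `S'`. Then each `S ∈ E` holds in some clone failing `S'`,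
hence in `Pol B`, since minor homomorphisms preserve minor conditions. So `P1` pp-constructs `B`,
which by `PPConstructs.nonempty_minorHom` gives a minor homomorphism `Pol P1 → Pol B`. But `Pol P1`
satisfies `S'` and `Pol B` does not. This is `exists_impliesOnFinite`. For quasi Maltsev, `B` is the
Boolean structure with disjunction and both constants (`nonempty_minorHom_orRel`). For a group, `B`
is `prim(G)` with the graphs of the action as relations (`nonempty_minorHom_actionRel`);
universality comes from the fact that every `G`-set without fixed points maps equivariantly to
`prim(G)`. -/

theorem Clone.minor_mem {C : Type*} (𝒞 : Clone C) {n m : ℕ} {f : (Fin n → C) → C}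
    (hf : f ∈ 𝒞.ops n) (σ : Fin n → Fin m) : (fun c : Fin m → C => f (fun i => c (σ i))) ∈ 𝒞.ops m :=
  𝒞.comp_mem hf fun i => 𝒞.proj_mem (σ i)

/-- The minor of an operation of a clone along a map of its arguments. -/
def Clone.minor {C : Type*} (𝒞 : Clone C) {n m : ℕ} (f : 𝒞.ops n) (σ : Fin n → Fin m) : 𝒞.ops m :=
  ⟨_, 𝒞.minor_mem f.2 σ⟩

/-- A minor homomorphism: an arity-preserving map of clones that commutes with taking minors. -/
structure Clone.MinorHom {C D : Type*} (𝒞 : Clone C) (𝒟 : Clone D) where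
  toFun : ∀ {n : ℕ}, 𝒞.ops n → 𝒟.ops n
  map_minor : ∀ {n m : ℕ} (f : 𝒞.ops n) (σ : Fin n → Fin m),
    toFun (𝒞.minor f σ) = 𝒟.minor (toFun f) σ

theorem Clone.MinorHom.satisfies {C D : Type*} {𝒞 : Clone C} {𝒟 : Clone D} (ξ : 𝒞.MinorHom 𝒟)
    {S : MinorCondition} (h : 𝒞.Satisfies S) : 𝒟.Satisfies S := by
  obtain ⟨f, hf, hid⟩ := h
  refine ⟨fun i => (ξ.toFun ⟨f i, hf i⟩).1, fun i => (ξ.toFun _).2, fun e he x => ?_⟩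
  have key : 𝒞.minor ⟨f e.lhs, hf _⟩ e.σ = 𝒞.minor ⟨f e.rhs, hf _⟩ e.τ :=
    Subtype.ext (funext fun c => hid e he c)
  have := congrArg ξ.toFun key
  rw [ξ.map_minor, ξ.map_minor] at this
  exact congrFun (congrArg Subtype.val this) x

/-! ### Primitive positive constructions induce minor homomorphisms -/

theorem realize_polymorphism {L : FirstOrder.Language} [L.IsRelational] {A : Type*} [L.Structure A] {n : ℕ}
    (f : (Fin n → A) → A) {α : Type*} (t : L.Term α) (v : Fin n → α → A) :
    t.realize (fun a => f fun i => v i a) = f fun i => t.realize (v i) := by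
  cases t with
  | var a => rfl
  | func g _ => exact isEmptyElim g

theorem IsPP.realize_polymorphism {L : FirstOrder.Language} [L.IsRelational] {A : Type*} [L.Structure A]
    {n : ℕ} (hn : 0 < n) {f : (Fin n → A) → A} (hf : IsPolymorphism L A f) {α : Type*} {l : ℕ}
    {φ : L.BoundedFormula α l} (hφ : IsPP φ) (v : Fin n → α → A) (xs : Fin n → Fin l → A)
    (h : ∀ i, φ.Realize (v i) (xs i)) :
    φ.Realize (fun a => f fun i => v i a) (fun j => f fun i => xs i j) := by
  have elim : ∀ {l : ℕ} (xs : Fin n → Fin l → A),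
      (Sum.elim (fun a => f fun i => v i a) (fun j => f fun i => xs i j)) =
        fun a => f fun i => Sum.elim (v i) (xs i) a := by
    intro l xs
    ext (a | j) <;> rfl
  induction hφ with
  | atomic hφ =>
    cases hφ with
    | equal t₁ t₂ =>
      simp only [FirstOrder.Language.BoundedFormula.realize_bdEqual, elim, _root_.realize_polymorphism] at h ⊢
      simp only [h]
    | rel R ts =>
      simp only [FirstOrder.Language.BoundedFormula.realize_rel, elim, _root_.realize_polymorphism] at h ⊢
      exact hf _ R _ h
  -- Positive arity matters here: a nullary operation need not preserve `⊥`.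
  | falsum => exact (h ⟨0, hn⟩).elim
  | inf _ _ ih₁ ih₂ =>
    simp only [FirstOrder.Language.BoundedFormula.realize_inf] at h ⊢
    exact ⟨ih₁ xs fun i => (h i).1, ih₂ xs fun i => (h i).2⟩
  | ex _ ih =>
    simp only [FirstOrder.Language.BoundedFormula.realize_ex] at h ⊢
    choose a ha using h
    refine ⟨f a, ?_⟩
    convert ih (fun i => Fin.snoc (xs i) (a i)) ha using 1
    ext j
    refine Fin.lastCases ?_ (fun j => ?_) j <;> simp

/-- A polymorphism `f` of `A` acts coordinatewise on `A^d` and preserves the pp-definable relations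
there; composing with the homomorphisms `q : B → A^d` inside and `p : A^d → B` outside gives a
polymorphism of `B`. Neither step disturbs minors. -/
theorem PPConstructs.nonempty_minorHom {L : FirstOrder.Language} [L.IsRelational] {A : Type*} [L.Structure A]
    {L' : FirstOrder.Language} [L'.IsRelational] {B : Type*} [L'.Structure B] (h : PPConstructs L A L' B) :
    Nonempty ((Pol L A).MinorHom (Pol L' B)) := by
  obtain ⟨d, _, _, hdef, ⟨p⟩, ⟨q⟩⟩ := h
  refine ⟨⟨fun {n} f => ⟨fun b => p fun j => f.1 fun i => q (b i) j, f.2.1, ?_⟩, fun _ _ => rfl⟩⟩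
  intro k R t ht
  obtain ⟨φ, hφ, hR⟩ := hdef k R
  refine p.map_rel R (fun s j => f.1 fun i => q (t i s) j) ((hR _).2 ?_)
  have := hφ.realize_polymorphism f.2.1 f.2.2 (fun i (a : Fin k × Fin d) => q (t i a.1) a.2)
    (fun _ => default) fun i => (hR fun s => q (t i s)).1 (q.map_rel R _ (ht i))
  unfold FirstOrder.Language.Formula.Realize
  convert this using 1

/-! ### Structures given by a family of binary relations -/

/-- Binary relation symbols indexed by `ι`. -/
inductive FamilySymbol (ι : Type) : ℕ → Type
  | mk : ι → FamilySymbol ι 2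

/-- The language with binary relation symbols indexed by `ι`. -/
def familyLanguage (ι : Type) : FirstOrder.Language.{0, 0} := ⟨fun _ => Empty, FamilySymbol ι⟩

instance familyLanguage.instIsRelational (ι : Type) : (familyLanguage ι).IsRelational :=
  fun _ => inferInstanceAs (IsEmpty Empty)

/-- The structure whose relations are the members of the family `R`. -/
@[reducible]
def familyStructure {ι A : Type} (R : ι → A → A → Prop) : (familyLanguage ι).Structure A where
  funMap g := (g : Empty).elim
  RelMap {n} (r : FamilySymbol ι n) := match n, r with
    | _, .mk i => fun t => R i (t 0) (t 1)

/-- The clone of the operations that preserve every relation of the family `R`. -/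
def familyPol {ι A : Type} (R : ι → A → A → Prop) : Clone A :=
  letI := familyStructure R
  Pol (familyLanguage ι) A

theorem mem_familyPol {ι A : Type} {R : ι → A → A → Prop} {n : ℕ} {f : (Fin n → A) → A} :
    f ∈ (familyPol R).ops n ↔ 0 < n ∧
      ∀ i (s t : Fin n → A), (∀ j, R i (s j) (t j)) → R i (f s) (f t) :=
  ⟨fun h => ⟨h.1, fun i s t ht => h.2 2 (FamilySymbol.mk i) (fun j => ![s j, t j]) ht⟩, fun h =>
    ⟨h.1, fun k r t ht => by
      cases r with | mk i => exact h.2 i (fun j => t j 0) (fun j => t j 1) ht⟩⟩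

/-- If `Pol P₁` satisfies `S'`, but `familyPol R` does not, and every clone that fails `S'` maps to
`familyPol R`, then a member of `E` implies `S'`. -/
theorem exists_impliesOnFinite (E : Set MinorCondition)
    (hE : ∀ (L : FirstOrder.Language.{0, 0}) [L.IsRelational] (A : Type) [L.Structure A]
      [Finite A] [Nonempty A],
      (∀ S ∈ E, (Pol L A).Satisfies S) → PPConstructs FirstOrder.Language.graph P1 L A)
    {S' : MinorCondition} {ι A : Type} [Finite A] [Nonempty A]
    (R : ι → A → A → Prop) (hP : (Pol FirstOrder.Language.graph P1).Satisfies S')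
    (hR : ¬ (familyPol R).Satisfies S')
    (hC : ∀ (C : Type u) (𝒞 : Clone C), ¬ 𝒞.Satisfies S' →
      Nonempty (𝒞.MinorHom (familyPol R))) :
    ∃ S ∈ E, MinorCondition.ImpliesOnFinite.{u} S S' := by
  let := familyStructure R
  by_contra! hne
  obtain ⟨ξ⟩ := (hE (familyLanguage ι) A fun S hS => by
    have := hne S hS
    unfold MinorCondition.ImpliesOnFinite at this
    push Not at this
    obtain ⟨C, _, 𝒞, h, h'⟩ := this
    obtain ⟨ξ⟩ := hC C 𝒞 h'
    exact ξ.satisfies h).nonempty_minorHom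
  exact hR (ξ.satisfies hP)

/-- With a single edge, the only tuples to check are constant, so idempotence suffices. -/
theorem mem_pol_P1 {n : ℕ} (hn : 0 < n) {f : (Fin n → P1) → P1} (hf : ∀ a, f (fun _ => a) = a) :
    f ∈ (Pol FirstOrder.Language.graph P1).ops n := by
  refine ⟨hn, fun k r t ht => ?_⟩
  cases r with
  | adj =>
    have h : ∀ i, t i 0 = .source ∧ t i 1 = .target := ht
    change f (fun i => t i 0) = .source ∧ f (fun i => t i 1) = .target
    simp only [h, hf, and_self]

/-! ### The quasi Maltsev condition -/

theorem satisfies_quasiMaltsev_iff {C : Type*} {𝒞 : Clone C} : 𝒞.Satisfies quasiMaltsev ↔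
    ∃ f ∈ 𝒞.ops 3, ∀ x y, f ![x, x, x] = f ![x, y, y] ∧ f ![x, y, y] = f ![y, y, x] := by
  have e (f : (Fin 3 → C) → C) (c : Fin 2 → C) (a b d : Fin 2) :
      f (fun i => c ((![a, b, d] : Fin 3 → Fin 2) i)) = f ![c a, c b, c d] := by
    congr 1; ext i; fin_cases i <;> rfl
  constructor
  · rintro ⟨f, hf, h⟩
    refine ⟨f (0 : Fin 1), hf (0 : Fin 1), fun x y => ⟨?_, ?_⟩⟩
    · have := h _ (Or.inl rfl) ![x, y]
      exact (e _ _ _ _ _).symm.trans (this.trans (e _ _ _ _ _))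
    · have := h _ (Or.inr rfl) ![x, y]
      exact (e _ _ _ _ _).symm.trans (this.trans (e _ _ _ _ _))
  · rintro ⟨f, hf, h⟩
    refine ⟨fun _ => f, fun _ => hf, ?_⟩
    rintro _ (rfl | rfl) x
    · exact (e f x _ _ _).trans ((h (x 0) (x 1)).1.trans (e f x _ _ _).symm)
    · exact (e f x _ _ _).trans ((h (x 0) (x 1)).2.trans (e f x _ _ _).symm)

open Classical in
theorem pol_P1_satisfies_quasiMaltsev : (Pol FirstOrder.Language.graph P1).Satisfies quasiMaltsev := by
  refine satisfies_quasiMaltsev_iff.2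
    -- An idempotent Maltsev operation.
    ⟨fun c => if c 0 = c 1 then c 2 else c 0, mem_pol_P1 (by decide) fun a => by simp, fun x y => ?_⟩
  by_cases h : x = y <;> simp [h]

/-- The relations `x = y = b` and `x ∨ y` on the two-element set; `none` stands for the
disjunction. -/
def orRel : Option Bool → Bool → Bool → Prop
  | none => fun x y => x = true ∨ y = true
  | some b => fun x y => x = b ∧ y = b

theorem mem_familyPol_orRel {n : ℕ} {f : (Fin n → Bool) → Bool} :
    f ∈ (familyPol orRel).ops n ↔ 0 < n ∧ (∀ b, f (fun _ => b) = b) ∧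
      ∀ s t : Fin n → Bool, (∀ i, s i = true ∨ t i = true) → f s = true ∨ f t = true := by
  rw [mem_familyPol]
  refine and_congr_right fun _ => ⟨fun h => ⟨fun b => ?_, h none⟩, fun h => ?_⟩
  · exact (h (some b) (fun _ => b) (fun _ => b) fun _ => ⟨rfl, rfl⟩).1
  · rintro (_ | b) s t ht
    · exact h.2 s t ht
    · obtain rfl : s = fun _ => b := funext fun i => (ht i).1
      obtain rfl : t = fun _ => b := funext fun i => (ht i).2
      exact ⟨h.1 b, h.1 b⟩

/-- The identities and idempotence force `f(0,1,1) = f(1,1,0) = f(0,0,0) = 0`, although the two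
argument tuples cover all coordinates by ones. -/
theorem not_familyPol_orRel_satisfies_quasiMaltsev :
    ¬ (familyPol orRel).Satisfies quasiMaltsev := by
  rw [satisfies_quasiMaltsev_iff]
  rintro ⟨f, hf, h⟩
  obtain ⟨-, hid, hor⟩ := mem_familyPol_orRel.1 hf
  have h0 : f ![false, false, false] = false := by
    convert hid false using 2
    ext i; fin_cases i <;> rfl
  have h1 := (h false true).1
  have h2 := (h false true).2
  have := hor ![false, true, true] ![true, true, false] fun i => by fin_cases i <;> simp
  simp_all

open Classical in
/-- A clone without a quasi Maltsev operation has a minor homomorphism to the clone of idempotent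
Boolean operations that preserve the disjunction. -/
theorem nonempty_minorHom_orRel {C : Type*} {𝒞 : Clone C} (h𝒞 : ¬ 𝒞.Satisfies quasiMaltsev) :
    Nonempty (𝒞.MinorHom (familyPol orRel)) := by
  rw [satisfies_quasiMaltsev_iff] at h𝒞
  push Not at h𝒞
  -- A set `s` of arguments gets the value true when changing exactly these arguments of some
  -- constant tuple, all to one common value, can change the value of `f`.
  refine ⟨⟨fun {n} f => ⟨fun s => decide (¬ ∀ x y : C,
      f.1 (fun i => if s i then y else x) = f.1 (fun _ => x)),
    mem_familyPol_orRel.2 ⟨𝒞.arity_pos f.2, ?_, ?_⟩⟩, fun _ _ => rfl⟩⟩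
  · rintro (_ | _)
    · simp
    · simp only [if_true, decide_eq_true_eq]
      intro hc
      -- If `f` were constant on the diagonal, this ternary minor would be constant, hence quasi
      -- Maltsev.
      obtain ⟨x, y, hxy⟩ := h𝒞 _ (𝒞.minor_mem f.2 fun _ => (0 : Fin 3))
      exact hxy (hc x x) (hc x y).symm
  · intro s t hst
    simp only [decide_eq_true_eq]
    by_contra! hc
    obtain ⟨hs, ht⟩ := hc
    -- Since `s` and `t` cover all arguments, this minor turns `(x,y,y)` into `y` on `s` and `x`
    -- elsewhere, and `(y,y,x)` into `y` on `t` and `x` elsewhere. If both sets had the value false,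
    -- it would be quasi Maltsev.
    obtain ⟨x, y, hxy⟩ := h𝒞 _ (𝒞.minor_mem f.2
      fun i => if s i then (if t i then (1 : Fin 3) else 2) else 0)
    have e1 : ∀ i, (![x, x, x] : Fin 3 → C)
        (if s i then (if t i then (1 : Fin 3) else 2) else 0) = x := by
      intro i; split_ifs <;> rfl
    have e2 : ∀ i, (![x, y, y] : Fin 3 → C)
        (if s i then (if t i then (1 : Fin 3) else 2) else 0) = if s i then y else x := by
      intro i; split_ifs <;> rfl
    have e3 : ∀ i, (![y, y, x] : Fin 3 → C)
        (if s i then (if t i then (1 : Fin 3) else 2) else 0) = if t i then y else x := by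
      intro i
      rcases hst i with h | h <;> simp only [h, if_true] <;> split_ifs <;> rfl
    simp only [e1, e2, e3] at hxy
    exact hxy (hs x y).symm ((hs x y).trans (ht x y).symm)

/-! ### Group actions -/

/-- On each orbit fix a representative `r` and send `g • r` to `g • z r`; the inclusion of
stabilizers makes this independent of `g`. -/
theorem exists_equivariant_of_stabilizer_le (G : Type*) [Group G] {X Z : Type*} [MulAction G X]
    [MulAction G Z] (h : ∀ x : X, ∃ z : Z, MulAction.stabilizer G x ≤ MulAction.stabilizer G z) :
    ∃ φ : X → Z, ∀ (g : G) (x : X), φ (g • x) = g • φ x := by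
  choose z hz using h
  let r (x : X) : X := (Quotient.mk (MulAction.orbitRel G X) x).out
  have hr (x : X) : ∃ g : G, g • r x = x :=
    (MulAction.orbitRel G X).symm (Quotient.mk_out (s := MulAction.orbitRel G X) x)
  choose k hk using hr
  have hrs (g : G) (x : X) : r (g • x) = r x :=
    congrArg Quotient.out (Quotient.sound (s := MulAction.orbitRel G X) ⟨g, rfl⟩)
  refine ⟨fun x => k x • z (r x), fun g x => ?_⟩
  have hmem : (g * k x)⁻¹ * k (g • x) ∈ MulAction.stabilizer G (r x) := by
    rw [MulAction.mem_stabilizer_iff, mul_smul, inv_smul_eq_iff, mul_smul, hk]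
    have := hk (g • x)
    rwa [hrs] at this
  have := hz _ hmem
  rw [MulAction.mem_stabilizer_iff, mul_smul, inv_smul_eq_iff, mul_smul] at this
  beta_reduce
  rw [hrs]
  exact this

/-- A `G`-set without fixed points maps to `prim(G)`. -/
theorem exists_equivariant_prim (G : Type*) [Group G] [Finite G] {X : Type*} [MulAction G X]
    (h : ∀ x : X, ∃ g : G, g • x ≠ x) :
    ∃ φ : X → Prim G, ∀ (g : G) (x : X), φ (g • x) = g • φ x := by
  refine exists_equivariant_of_stabilizer_le G fun x => ?_
  have hx : MulAction.stabilizer G x ≠ ⊤ := by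
    intro htop
    obtain ⟨g, hg⟩ := h x
    exact hg (MulAction.mem_stabilizer_iff.1 (htop ▸ Subgroup.mem_top g))
  -- A proper stabilizer lies in a maximal subgroup `M`, which is the stabilizer of the trivial
  -- coset in the primitive `G`-set `G ⧸ M`.
  obtain ⟨M, hM, hle⟩ := (eq_top_or_exists_le_coatom _).resolve_left hx
  obtain ⟨e, he⟩ := (primSetoid G).symm (Quotient.mk_out (s := primSetoid G) ⟨M, hM⟩)
  refine ⟨⟨Quotient.mk _ ⟨M, hM⟩, e ((1 : G) : G ⧸ M)⟩, fun g hg => ?_⟩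
  rw [MulAction.mem_stabilizer_iff]
  refine congrArg (Sigma.mk _) ((he g _).symm.trans (congrArg e ?_))
  have hgM : g ∈ MulAction.stabilizer G ((1 : G) : G ⧸ M) := by
    rw [MulAction.stabilizer_quotient]
    exact hle hg
  exact hgM

/-- `prim(G)` has no fixed points. -/
theorem exists_smul_ne_prim (G : Type*) [Group G] (p : Prim G) : ∃ g : G, g • p ≠ p := by
  obtain ⟨q, x⟩ := p
  obtain ⟨g, rfl⟩ := QuotientGroup.mk_surjective x
  obtain ⟨hn, _⟩ := primComponent_isPrimitive G q
  obtain ⟨y, hy⟩ := exists_ne ((g : G) : PrimComponent G q)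
  obtain ⟨k, hk⟩ := MulAction.exists_smul_eq G ((g : G) : PrimComponent G q) y
  refine ⟨k, fun h => hy ?_⟩
  rw [Sigma.smul_def] at h
  exact hk.symm.trans (eq_of_heq (Sigma.mk.inj h).2)

section Action

variable (H Y : Type v) [Group H] [MulAction H Y] [Finite Y]

/-- The action of `H` on the numbers of the elements of `Y`. -/
noncomputable def numberedAction (h : H) (i : Fin (Nat.card Y)) : Fin (Nat.card Y) :=
  Finite.equivFin Y (h • (Finite.equivFin Y).symm i)

theorem numberedAction_symm (h : H) (i : Fin (Nat.card Y)) :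
    (Finite.equivFin Y).symm (numberedAction H Y h i) = h • (Finite.equivFin Y).symm i := by
  simp [numberedAction]

theorem numberedAction_mul (g h : H) (i : Fin (Nat.card Y)) :
    numberedAction H Y (g * h) i = numberedAction H Y g (numberedAction H Y h i) := by
  simp [numberedAction, mul_smul]

/-- The graphs of the maps by which `H` acts. -/
def actionRel (π : {π : Fin (Nat.card Y) → Fin (Nat.card Y) // ∃ h : H, π = numberedAction H Y h})
    (i j : Fin (Nat.card Y)) : Prop :=
  j = π.1 i

/-- Preserving the graph of a map means commuting with it. Indexing the relations by the maps
themselves keeps the signature in `Type`, whatever the universe of `H`. -/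
theorem mem_familyPol_actionRel {n : ℕ} {f : (Fin n → Fin (Nat.card Y)) → Fin (Nat.card Y)} :
    f ∈ (familyPol (actionRel H Y)).ops n ↔ 0 < n ∧ ∀ (h : H) t,
      f (fun i => numberedAction H Y h (t i)) = numberedAction H Y h (f t) := by
  rw [mem_familyPol]
  refine and_congr_right fun _ => ⟨fun hf h t => ?_, ?_⟩
  · exact hf ⟨_, h, rfl⟩ t (fun i => numberedAction H Y h (t i)) fun _ => rfl
  · rintro hf ⟨_, h, rfl⟩ s t ht
    obtain rfl : t = fun i => numberedAction H Y h (s i) := funext ht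
    exact hf h s

variable [Finite H] [Nonempty Y]

theorem satisfies_actionCondition_iff {C : Type*} {𝒞 : Clone C} :
    𝒞.Satisfies (actionCondition H Y) ↔ ∃ f ∈ 𝒞.ops (Nat.card Y), ∀ (h : H) t,
      f t = f fun i => t (numberedAction H Y h i) :=
  ⟨fun ⟨f, hf, hid⟩ => ⟨f (0 : Fin 1), hf (0 : Fin 1), fun h t => hid _ ⟨h, rfl⟩ t⟩,
    fun ⟨f, hf, hid⟩ => ⟨fun _ => f, fun _ => hf, by rintro _ ⟨h, rfl⟩ t; exact hid h t⟩⟩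

open Classical in
theorem pol_P1_satisfies_actionCondition :
    (Pol FirstOrder.Language.graph P1).Satisfies (actionCondition H Y) := by
  refine (satisfies_actionCondition_iff H Y).2
    -- The conjunction is idempotent and symmetric under all permutations of its arguments.
    ⟨fun c => if ∀ i, c i = .target then .target else .source, mem_pol_P1 Nat.card_pos ?_, ?_⟩
  · have : Nonempty (Fin (Nat.card Y)) := ⟨⟨0, Nat.card_pos⟩⟩
    rintro (_ | _) <;> simp
  · intro h t
    have : (∀ i, t i = .target) ↔ ∀ i, t (numberedAction H Y h i) = .target := by
      refine ⟨fun ht i => ht _, fun ht i => ?_⟩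
      simpa [numberedAction] using ht (numberedAction H Y h⁻¹ i)
    simp only [this]

/-- For an equivariant and `H`-invariant `f`, the value at the identity tuple, which lists all of
`Y`, would be a fixed point of `H`. -/
theorem not_familyPol_actionRel_satisfies_actionCondition
    (hY : ∀ y : Y, ∃ h : H, h • y ≠ y) :
    ¬ (familyPol (actionRel H Y)).Satisfies (actionCondition H Y) := by
  rw [satisfies_actionCondition_iff]
  rintro ⟨f, hf, hid⟩
  obtain ⟨-, hf⟩ := (mem_familyPol_actionRel H Y).1 hf
  obtain ⟨h, hh⟩ := hY ((Finite.equivFin Y).symm (f id))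
  rw [← numberedAction_symm] at hh
  exact hh (congrArg _ ((hf h id).symm.trans (hid h id).symm))

/-- `H` acts on the operations of a clone whose arguments are indexed by `Y`. -/
@[reducible]
noncomputable def opsAction {C : Type*} (𝒞 : Clone C) : MulAction H (𝒞.ops (Nat.card Y)) where
  smul h f := 𝒞.minor f (numberedAction H Y h)
  one_smul f := by
    refine Subtype.ext (funext fun c => congrArg f.1 (funext fun i => ?_))
    simp [numberedAction]
  mul_smul g h f := by
    refine Subtype.ext (funext fun c => congrArg f.1 (funext fun i => ?_))
    simp [numberedAction_mul]

/-- Fixed points of `H` on the operations with arguments indexed by `Y` are exactly the witnesses of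
the condition. If there are none, `hY` gives an equivariant `φ` from these operations to `Y`, and
`f` is sent to the operation `y ↦ φ (minor of f along y)`. -/
theorem nonempty_minorHom_actionRel
    {C : Type u} {𝒞 : Clone C} (h𝒞 : ¬ 𝒞.Satisfies (actionCondition H Y))
    (hY : ∀ (X : Type u) [MulAction H X], (∀ x : X, ∃ h : H, h • x ≠ x) →
      ∃ φ : X → Y, ∀ (h : H) (x : X), φ (h • x) = h • φ x) :
    Nonempty (𝒞.MinorHom (familyPol (actionRel H Y))) := by
  let := opsAction H Y 𝒞
  obtain ⟨φ, hφ⟩ := hY (𝒞.ops (Nat.card Y)) fun f => by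
    by_contra! hf
    exact h𝒞 ((satisfies_actionCondition_iff H Y).2 ⟨f.1, f.2, fun h t =>
      (congrFun (congrArg Subtype.val (hf h)) t).symm⟩)
  refine ⟨⟨fun {n} f => ⟨fun y => Finite.equivFin Y (φ (𝒞.minor f y)),
    (mem_familyPol_actionRel H Y).2 ⟨𝒞.arity_pos f.2, fun h t => ?_⟩⟩, fun _ _ => rfl⟩⟩
  have : 𝒞.minor f (fun i => numberedAction H Y h (t i)) = h • 𝒞.minor f t := rfl
  rw [this, hφ]
  simp [numberedAction]

end Action

theorem mainTheorem8 (E : Set MinorCondition)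
    (hE : ∀ (L : FirstOrder.Language.{0, 0}) [L.IsRelational] (A : Type) [L.Structure A]
      [Finite A] [Nonempty A],
      (∀ S ∈ E, (Pol L A).Satisfies S) → PPConstructs FirstOrder.Language.graph P1 L A) :
    ∀ S' ∈ ({quasiMaltsev} ∪
        {S | ∃ (G : Type v) (_ : Group G) (_ : Finite G) (_ : IsSimpleGroup G),
          S = actionCondition G (Prim G)} : Set MinorCondition),
      ∃ S ∈ E, MinorCondition.ImpliesOnFinite.{u} S S' := by
  rintro S' (rfl | ⟨G, _, _, _, rfl⟩)
  · exact exists_impliesOnFinite E hE orRel pol_P1_satisfies_quasiMaltsev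
      not_familyPol_orRel_satisfies_quasiMaltsev fun _ _ => nonempty_minorHom_orRel
  · have : Nonempty (Fin (Nat.card (Prim G))) := ⟨⟨0, Nat.card_pos⟩⟩
    exact exists_impliesOnFinite E hE (actionRel G (Prim G))
      (pol_P1_satisfies_actionCondition G (Prim G))
      (not_familyPol_actionRel_satisfies_actionCondition G (Prim G) (exists_smul_ne_prim G))
      fun _ _ h => nonempty_minorHom_actionRel G (Prim G) h fun _ _ => exists_equivariant_prim G
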